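/- Let $F$ be an arbitrary field and let $\mathbb{O}=M_2(F)\oplus vM_2(F)$ be the split Cayley--Dickson algebra over $F$, with multiplication \[a\cdot b=ab,\qquad a\cdot vb=v(\bar a b),\qquad va\cdot b=v(ba),\qquad va\cdot vb=b\bar a\qquad(a,b\in M_2(F)),\] where $\overline{\begin{pmatrix}a&b\\c&d\end{pmatrix}}=\begin{pmatrix}d&-b\\-c&a\end{pmatrix}$, and let $e_{ij}$ be the matrix units of $M_2(F)$. A linear map $R:\mathbb{O}\to\mathbb{O}$ is a Rota--Baxter operator of weight $\lambda\in F$ if $R(x)R(y)=R(R(x)y+xR(y)+\lambda xy)$ for all $x,y\in\mathbb{O}$. If $\lambda\ne0$, it is called splitting if $\mathbb{O}=A_1\oplus A_2$ (direct sum of vector spaces) for some subalgebras $A_1,A_2$ (not required to contain the unit) with $R|_{A_1}=-\lambda\,\mathrm{id}$ and $R|_{A_2}=0$. For a Rota--Baxter operator $R$ of weight $\lambda$ put $\phi(R)=-R-\lambda\,\mathrm{id}$. Let $R_1:\mathbb{O}\to\mathbb{O}$ be the linear map that is $0$ on $Fe_{11}+Fe_{12}+Fve_{11}+Fve_{12}$,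 is $-\mathrm{id}$ on $Fe_{21}+Fve_{21}+Fve_{22}$, and satisfies $R_1(e_{22})=e_{11}$. **Theorem.** Let $R$ be a non-splitting Rota--Baxter operator of nonzero weight $\lambda$ on $\mathbb{O}$. Then there are a nonzero scalar $c\in F$ and a linear bijection $\psi:\mathbb{O}\to\mathbb{O}$ which is an automorphism or an anti-automorphism of the algebra $\mathbb{O}$ such that \[\psi\circ(cR)\circ\psi^{-1}=R_1\qquad\text{or}\qquad \psi\circ(c\,\phi(R))\circ\psi^{-1}=R_1 .\] -/

import Mathlib

/-! ### Rota-Baxter operators on (not necessarily associative) algebras -/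

section RotaBaxter

variable {F A : Type*} [Field F] [NonUnitalNonAssocRing A] [Module F A]

/-- `R` is a Rota-Baxter operator of weight `lam` on the algebra `A`. -/
def IsRotaBaxter (lam : F) (R : A →ₗ[F] A) : Prop :=
  ∀ x y : A, R x * R y = R (R x * y + x * R y + lam • (x * y))

/-- `R` is splitting (with respect to the weight `lam`): `A` is the direct sum of two subalgebras
(not required to contain a unit), `R` is `-lam • id` on the first one and `0` on the second. -/
def IsSplittingRB (lam : F) (R : A →ₗ[F] A) : Prop :=
  ∃ A₁ A₂ : NonUnitalSubalgebra F A,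
    IsCompl A₁.toSubmodule A₂.toSubmodule ∧
    (∀ x ∈ A₁, R x = -(lam • x)) ∧ (∀ x ∈ A₂, R x = 0)

/-- The transformation `φ(R) = -R - lam • id` of operators of weight `lam`. -/
def phiRB (lam : F) (R : A →ₗ[F] A) : A →ₗ[F] A :=
  -R - lam • LinearMap.id

/-- The linear bijection `ψ` is an automorphism of the algebra `A`. -/
def IsAlgAut (ψ : A ≃ₗ[F] A) : Prop :=
  ∀ x y : A, ψ (x * y) = ψ x * ψ y

/-- The linear bijection `ψ` is an anti-automorphism of the algebra `A`. -/
def IsAlgAntiAut (ψ : A ≃ₗ[F] A) : Prop :=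
  ∀ x y : A, ψ (x * y) = ψ y * ψ x

end RotaBaxter

/-! ### The split Cayley-Dickson algebra `M₂(F) + v M₂(F)` -/

/-- The symplectic involution of `M₂(F)`. -/
def sympInv {F : Type*} [Field F] (a : Matrix (Fin 2) (Fin 2) F) : Matrix (Fin 2) (Fin 2) F :=
  !![a 1 1, -(a 0 1); -(a 1 0), a 0 0]

/-- The split Cayley-Dickson algebra `M₂(F) + v M₂(F)`: the element with components `m` and `w`
stands for `m + v w`. -/
@[ext]
structure SplitOctonion (F : Type*) where
  m : Matrix (Fin 2) (Fin 2) F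
  w : Matrix (Fin 2) (Fin 2) F

namespace SplitOctonion

variable {F : Type*} [Field F]

instance : Zero (SplitOctonion F) := ⟨⟨0, 0⟩⟩
instance : Add (SplitOctonion F) := ⟨fun x y => ⟨x.m + y.m, x.w + y.w⟩⟩
instance : Neg (SplitOctonion F) := ⟨fun x => ⟨-x.m, -x.w⟩⟩
instance : Sub (SplitOctonion F) := ⟨fun x y => ⟨x.m - y.m, x.w - y.w⟩⟩
instance : SMul ℕ (SplitOctonion F) := ⟨fun n x => ⟨n • x.m, n • x.w⟩⟩
instance : SMul ℤ (SplitOctonion F) := ⟨fun n x => ⟨n • x.m, n • x.w⟩⟩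
instance : SMul F (SplitOctonion F) := ⟨fun c x => ⟨c • x.m, c • x.w⟩⟩

/-- The multiplication given by `a · b = ab`, `a · vb = v(āb)`, `va · b = v(ba)`,
`va · vb = b ā`, where the bar is the symplectic involution. -/
instance : Mul (SplitOctonion F) :=
  ⟨fun x y => ⟨x.m * y.m + y.w * sympInv x.w, sympInv x.m * y.w + y.m * x.w⟩⟩

@[simp] theorem zero_m : (0 : SplitOctonion F).m = 0 := rfl
@[simp] theorem zero_w : (0 : SplitOctonion F).w = 0 := rfl
@[simp] theorem add_m (x y : SplitOctonion F) : (x + y).m = x.m + y.m := rfl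
@[simp] theorem add_w (x y : SplitOctonion F) : (x + y).w = x.w + y.w := rfl
@[simp] theorem neg_m (x : SplitOctonion F) : (-x).m = -x.m := rfl
@[simp] theorem neg_w (x : SplitOctonion F) : (-x).w = -x.w := rfl
@[simp] theorem sub_m (x y : SplitOctonion F) : (x - y).m = x.m - y.m := rfl
@[simp] theorem sub_w (x y : SplitOctonion F) : (x - y).w = x.w - y.w := rfl
@[simp] theorem smul_m (c : F) (x : SplitOctonion F) : (c • x).m = c • x.m := rfl
@[simp] theorem smul_w (c : F) (x : SplitOctonion F) : (c • x).w = c • x.w := rfl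
@[simp] theorem mul_m (x y : SplitOctonion F) :
    (x * y).m = x.m * y.m + y.w * sympInv x.w := rfl
@[simp] theorem mul_w (x y : SplitOctonion F) :
    (x * y).w = sympInv x.m * y.w + y.m * x.w := rfl

theorem sympInv_add (a b : Matrix (Fin 2) (Fin 2) F) :
    sympInv (a + b) = sympInv a + sympInv b := by
  ext i j
  fin_cases i <;> fin_cases j <;> simp [sympInv] <;> ring

theorem sympInv_zero : sympInv (0 : Matrix (Fin 2) (Fin 2) F) = 0 := by
  ext i j
  fin_cases i <;> fin_cases j <;> simp [sympInv]

theorem toProd_injective :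
    Function.Injective (fun x : SplitOctonion F => (x.m, x.w)) := fun _ _ h =>
  SplitOctonion.ext (congrArg Prod.fst h) (congrArg Prod.snd h)

instance : AddCommGroup (SplitOctonion F) :=
  toProd_injective.addCommGroup _ rfl (fun _ _ => rfl) (fun _ => rfl) (fun _ _ => rfl)
    (fun _ _ => rfl) (fun _ _ => rfl)

instance : Module F (SplitOctonion F) :=
  toProd_injective.module F
    ({ toFun := fun x => (x.m, x.w), map_zero' := rfl, map_add' := fun _ _ => rfl } :
      SplitOctonion F →+ Matrix (Fin 2) (Fin 2) F × Matrix (Fin 2) (Fin 2) F)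
    (fun _ _ => rfl)

instance : NonUnitalNonAssocRing (SplitOctonion F) :=
  { (inferInstance : AddCommGroup (SplitOctonion F)),
    (inferInstance : Mul (SplitOctonion F)) with
    left_distrib := fun x y z => by
      ext1
      · simp only [mul_m, add_m, add_w, mul_add, add_mul]; abel
      · simp only [mul_w, add_m, add_w, mul_add, add_mul]; abel
    right_distrib := fun x y z => by
      ext1
      · simp only [mul_m, add_m, add_w, sympInv_add, mul_add, add_mul]; abel
      · simp only [mul_w, add_m, add_w, sympInv_add, mul_add, add_mul]; abel
    zero_mul := fun x => by
      ext1
      · simp only [mul_m, zero_m, zero_w, sympInv_zero, zero_mul, mul_zero, add_zero]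
      · simp only [mul_w, zero_m, zero_w, sympInv_zero, zero_mul, mul_zero, add_zero]
    mul_zero := fun x => by
      ext1
      · simp only [mul_m, zero_m, zero_w, zero_mul, mul_zero, add_zero]
      · simp only [mul_w, zero_m, zero_w, zero_mul, mul_zero, add_zero] }

theorem sympInv_smul (c : F) (a : Matrix (Fin 2) (Fin 2) F) :
    sympInv (c • a) = c • sympInv a := by
  ext i j
  fin_cases i <;> fin_cases j <;> simp [sympInv]

instance : IsScalarTower F (SplitOctonion F) (SplitOctonion F) :=
  ⟨fun c x y => by
    change (c • x) * y = c • (x * y)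
    ext1 <;> simp [sympInv_smul]⟩

instance : SMulCommClass F (SplitOctonion F) (SplitOctonion F) :=
  ⟨fun c x y => by
    change c • (x * y) = x * (c • y)
    ext1 <;> simp⟩

/-- The operator `R₁`: it is `0` on `e₁₁, e₁₂, ve₁₁, ve₁₂`, it is `-id` on `e₂₁, ve₂₁, ve₂₂`,
and it sends `e₂₂` to `e₁₁`. -/
def R₁ : SplitOctonion F →ₗ[F] SplitOctonion F where
  toFun x := ⟨!![x.m 1 1, 0; -(x.m 1 0), 0], !![0, 0; -(x.w 1 0), -(x.w 1 1)]⟩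
  map_add' x y := by
    ext i j <;> fin_cases i <;> fin_cases j <;> simp <;> ring
  map_smul' c x := by
    ext i j <;> fin_cases i <;> fin_cases j <;> simp

end SplitOctonion

/-! The scalar `c = lam⁻¹` reduces to weight `1`. The split octonions `A` are alternative, and every
`x` satisfies a quadratic equation given by its norm `N x` and its trace. Linearizing
`R x * R x = R (R x * x + x * R x + x * x)` with it shows that `R ^ 2 + R` takes its values in the
plane spanned by `R 1` and `1`. If `R ^ 2 + R` vanishes, then `A = ker (R + 1) ⊕ ker R` and `R` is
splitting; otherwise, for `R` or `φ(R)`, the element `e = R 1` is a primitive idempotent killed by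
`R`.

Then `R` acts on the Peirce space `A₁₀(e)` with eigenvalues `0` and `-1`. The alternating trilinear
form `(x, y, z) ↦ polar N x (y * z)` on it is nonzero, but vanishes on both eigenspaces, hence there
is a frame of eigenvectors with eigenvalues `(0, -1, -1)` or `(-1, 0, 0)`. A frame identifies `A`
with the split octonions; the first case is `R₁`, the second becomes `R₁` after transposition. -/

section RotaBaxter

variable {F A : Type*} [Field F] [NonUnitalNonAssocRing A] [Module F A] {lam : F} {R : A →ₗ[F] A}

theorem phiRB_apply (x : A) : phiRB lam R x = -R x - lam • x := rfl

theorem phiRB_smul (c lam : F) (R : A →ₗ[F] A) : phiRB (c * lam) (c • R) = c • phiRB lam R := by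
  ext x
  simp only [phiRB_apply, LinearMap.smul_apply, mul_smul, smul_sub, smul_neg]

theorem phiRB_eq_zero_iff {x : A} : phiRB lam R x = 0 ↔ R x = -(lam • x) := by
  rw [phiRB_apply, sub_eq_zero, neg_eq_iff_eq_neg]

theorem IsSplittingRB.smul (h : IsSplittingRB lam R) (c : F) :
    IsSplittingRB (c * lam) (c • R) := by
  obtain ⟨A₁, A₂, hcompl, h₁, h₂⟩ := h
  refine ⟨A₁, A₂, hcompl, fun x hx ↦ ?_, fun x hx ↦ ?_⟩
  · rw [LinearMap.smul_apply, h₁ x hx, smul_neg, mul_smul]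
  · rw [LinearMap.smul_apply, h₂ x hx, smul_zero]

namespace IsRotaBaxter

theorem map_mul_of_map_eq_zero (hR : IsRotaBaxter lam R) (hlam : lam ≠ 0) {x y : A}
    (hx : R x = 0) (hy : R y = 0) : R (x * y) = 0 := by
  have h := hR x y
  rw [hx, hy, zero_mul, mul_zero, zero_mul, add_zero, zero_add, map_smul] at h
  exact (smul_eq_zero.mp h.symm).resolve_left hlam

variable [IsScalarTower F A A] [SMulCommClass F A A]

theorem smul (hR : IsRotaBaxter lam R) (c : F) : IsRotaBaxter (c * lam) (c • R) := by
  intro x y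
  simp only [LinearMap.smul_apply, smul_mul_assoc, mul_smul_comm, ← smul_add, mul_smul, map_smul]
  rw [hR x y]

theorem phi (hR : IsRotaBaxter lam R) : IsRotaBaxter lam (phiRB lam R) := by
  intro x y
  have h := hR x y
  simp only [map_add, map_smul] at h
  simp only [phiRB_apply, sub_mul, mul_sub, neg_mul, mul_neg, smul_mul_assoc, mul_smul_comm,
    map_add, map_sub, map_neg, map_smul, h, smul_sub, smul_neg]
  abel

theorem map_mul_of_map_eq_neg (hR : IsRotaBaxter lam R) (hlam : lam ≠ 0) {x y : A}
    (hx : R x = -(lam • x)) (hy : R y = -(lam • y)) : R (x * y) = -(lam • (x * y)) :=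
  phiRB_eq_zero_iff.mp <| hR.phi.map_mul_of_map_eq_zero hlam
    (phiRB_eq_zero_iff.mpr hx) (phiRB_eq_zero_iff.mpr hy)

theorem isSplittingRB {R : A →ₗ[F] A} (hR : IsRotaBaxter (1 : F) R)
    (hsq : ∀ x, R (R x) + R x = 0) : IsSplittingRB (1 : F) R := by
  refine ⟨(LinearMap.ker (phiRB 1 R)).toNonUnitalSubalgebra
      fun x y hx hy ↦ hR.phi.map_mul_of_map_eq_zero one_ne_zero hx hy,
    (LinearMap.ker R).toNonUnitalSubalgebra
      fun x y hx hy ↦ hR.map_mul_of_map_eq_zero one_ne_zero hx hy,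
    ?_, fun x hx ↦ phiRB_eq_zero_iff.mp hx, fun x hx ↦ hx⟩
  change IsCompl (LinearMap.ker (phiRB 1 R)) (LinearMap.ker R)
  constructor
  · rw [Submodule.disjoint_def]
    intro x hx hy
    rw [LinearMap.mem_ker] at hx hy
    rwa [phiRB_apply, hy, neg_zero, zero_sub, neg_eq_zero, one_smul] at hx
  · rw [Submodule.codisjoint_iff_exists_add_eq]
    refine fun x ↦ ⟨-R x, x + R x, ?_, ?_, by abel⟩
    · rw [LinearMap.mem_ker, phiRB_apply, one_smul, map_neg, neg_neg, sub_neg_eq_add, hsq]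
    · rw [LinearMap.mem_ker, map_add, add_comm, hsq]

end IsRotaBaxter

theorem phiRB_one_apply (R : A →ₗ[F] A) (x : A) : phiRB 1 R x = -(R x + x) := by
  rw [phiRB_apply, one_smul]
  abel

end RotaBaxter

/-- Alternative multiplications, not assumed to have a unit. -/
class IsAlternative (A : Type*) [Mul A] : Prop where
  mul_mul_left (x y : A) : x * (x * y) = x * x * y
  mul_mul_right (x y : A) : y * x * x = y * (x * x)

namespace IsAlternative

variable {A : Type*} [NonUnitalNonAssocRing A] [IsAlternative A]

theorem mul_mul_add (x y z : A) : x * (y * z) + y * (x * z) = (x * y + y * x) * z := by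
  have h := mul_mul_left (x + y) z
  simp only [add_mul, mul_add, mul_mul_left x z, mul_mul_left y z] at h
  rw [add_mul, ← sub_eq_zero]
  rw [← sub_eq_zero] at h
  rw [← h]
  abel

theorem mul_add_mul_mul (x y z : A) : z * x * y + z * y * x = z * (x * y + y * x) := by
  have h := mul_mul_right (x + y) z
  simp only [add_mul, mul_add, mul_mul_right x z, mul_mul_right y z] at h
  rw [mul_add, ← sub_eq_zero]
  rw [← sub_eq_zero] at h
  rw [← h]
  abel

theorem flexible (x y : A) : x * y * x = x * (y * x) := by
  have h := mul_mul_add y x x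
  rw [add_mul, mul_mul_right, add_comm] at h
  exact (add_right_cancel (h.trans (add_comm _ _))).symm

end IsAlternative

section Quadratic

variable {F A : Type*} [Field F] [NonAssocRing A] [Module F A]

open QuadraticMap

/-- The linear trace form `x ↦ N(x, 1)` of a unital algebra with a quadratic form `N`. -/
def normTrace (N : QuadraticForm F A) : A →ₗ[F] F := N.polarBilin.flip 1

theorem normTrace_apply (N : QuadraticForm F A) (x : A) : normTrace N x = polar N x 1 := rfl

/-- The quadratic form `N` makes `A` a quadratic algebra: every `x` is a root of
`X ^ 2 - tr x • X + N x`. -/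
class IsQuadraticNorm (N : QuadraticForm F A) : Prop where
  apply_one : N 1 = 1
  mul_self (x : A) : x * x = normTrace N x • x - N x • 1

namespace IsQuadraticNorm

theorem nontrivial (N : QuadraticForm F A) [IsQuadraticNorm N] : Nontrivial A :=
  ⟨1, 0, fun h ↦ one_ne_zero (α := F) <| by rw [← apply_one (N := N), h, QuadraticMap.map_zero]⟩

theorem normTrace_ne_zero {N : QuadraticForm F A} [IsQuadraticNorm N]
    (hN : N.polarBilin.SeparatingLeft) : normTrace N ≠ 0 := by
  have := nontrivial N
  intro h
  refine one_ne_zero (hN 1 fun x ↦ ?_)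
  rw [polarBilin_apply_apply, polar_comm, ← normTrace_apply, h, LinearMap.zero_apply]

variable (N : QuadraticForm F A) [IsQuadraticNorm N]

theorem normTrace_one : normTrace N 1 = 2 := by
  rw [normTrace_apply, polar_self, apply_one, nsmul_eq_mul, mul_one, Nat.cast_ofNat]

theorem mul_add_mul (x y : A) :
    x * y + y * x = normTrace N x • y + normTrace N y • x - polar N x y • 1 := by
  have h := mul_self (N := N) (x + y)
  simp only [add_mul, mul_add, map_add, add_smul, smul_add, QuadraticMap.map_add N x y,
    mul_self (N := N) x, mul_self (N := N) y] at h
  rw [← sub_eq_zero] at h ⊢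
  rw [← h]
  abel

end IsQuadraticNorm

end Quadratic

section WeightOne

variable {F A : Type*} [Field F] [NonAssocRing A] [Module F A] {R : A →ₗ[F] A}

namespace IsRotaBaxter

theorem map_mul_map (hR : IsRotaBaxter (1 : F) R) (x y : A) :
    R x * R y = R (R x * y) + R (x * R y) + R (x * y) := by
  rw [hR x y, one_smul, map_add, map_add]

theorem map_map_add_eq_zero_of_map_one_eq_smul [IsScalarTower F A A]
    (hR : IsRotaBaxter (1 : F) R) {c : F} (hc : R 1 = c • 1) (x : A) : R (R x) + R x = 0 := by
  have h := hR.map_mul_map 1 x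
  rw [hc, smul_mul_assoc, smul_mul_assoc, one_mul, one_mul, map_smul, add_assoc] at h
  exact left_eq_add.mp h

theorem not_map_eq_one_and_map_add_eq_one [Nontrivial A] (hR : IsRotaBaxter (1 : F) R) {u v : A}
    (hu : R u = 1) (hv : R v + v = 1) : False := by
  have h := hR.map_mul_map u v
  rw [hu, one_mul, one_mul, add_assoc, ← map_add, ← mul_add, hv, mul_one, hu] at h
  exact one_ne_zero (left_eq_add.mp h)

end IsRotaBaxter

variable {N : QuadraticForm F A} {f g : A →ₗ[F] F}

open QuadraticMap IsQuadraticNorm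

/-- `R ^ 2 + R` takes its values in the plane spanned by `R 1` and `1`; its coordinates there are
`f` and `-g`, and they also determine the norms of `R x` and `R x + x`. -/
structure IsCoeffPair (N : QuadraticForm F A) (R : A →ₗ[F] A) (f g : A →ₗ[F] F) : Prop where
  linearIndependent : LinearIndependent F ![R 1, 1]
  sq_add (x : A) : R (R x) + R x = f x • R 1 - g x • 1
  norm_map (x : A) : N (R x) = normTrace N x * g x
  norm_map_add (x : A) : N (R x + x) = normTrace N x * (f x + g x)

section Existence

variable [IsQuadraticNorm N]

theorem IsRotaBaxter.normTrace_smul_sq_add (hR : IsRotaBaxter (1 : F) R) (x : A) :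
    normTrace N x • (R (R x) + R x) = (polar N x (R x) + N x) • R 1 - N (R x) • 1 := by
  have h := hR.map_mul_map x x
  rw [← map_add, mul_add_mul N, mul_self (N := N), mul_self (N := N), polar_comm] at h
  simp only [map_add, map_sub, map_smul] at h
  linear_combination (norm := module) -h

theorem IsRotaBaxter.normTrace_smul_sq_add_polar (hR : IsRotaBaxter (1 : F) R) (x y : A) :
    normTrace N x • (R (R y) + R y) + normTrace N y • (R (R x) + R x) =
      (polar N x (R y) + polar N y (R x) + polar N x y) • R 1 - polar N (R x) (R y) • 1 := by
  have h := hR.normTrace_smul_sq_add (N := N) (x + y)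
  simp only [map_add, QuadraticMap.map_add N, polar_add_left, polar_add_right] at h
  linear_combination (norm := module)
    h - hR.normTrace_smul_sq_add (N := N) x - hR.normTrace_smul_sq_add (N := N) y

theorem IsRotaBaxter.exists_isCoeffPair (hR : IsRotaBaxter (1 : F) R) (htr : normTrace N ≠ 0)
    (hlin : LinearIndependent F ![R 1, 1]) : ∃ f g, IsCoeffPair N R f g := by
  obtain ⟨z, hz⟩ := LinearMap.surjective htr 1
  let B := N.polarBilin
  let f := B z ∘ₗ R + B (R z) + B z - (polar N z (R z) + N z) • normTrace N
  let g := B (R z) ∘ₗ R - N (R z) • normTrace N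
  have hf x : f x = polar N z (R x) + polar N x (R z) + polar N z x -
      (polar N z (R z) + N z) * normTrace N x := by
    simp [f, B, polar_comm N x]
  have hg x : g x = polar N (R z) (R x) - N (R z) * normTrace N x := by
    simp [g, B]
  have sq_add x : R (R x) + R x = f x • R 1 - g x • 1 := by
    have hsq := hR.normTrace_smul_sq_add (N := N) z
    have hsq_polar := hR.normTrace_smul_sq_add_polar (N := N) z x
    rw [hz] at hsq hsq_polar
    rw [hf, hg]
    linear_combination (norm := module) hsq_polar - normTrace N x • hsq
  have norms x : polar N x (R x) + N x = normTrace N x * f x ∧ N (R x) = normTrace N x * g x := by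
    have hsq := hR.normTrace_smul_sq_add (N := N) x
    rw [sq_add] at hsq
    have h := hlin.eq_zero_of_pair
      (s := polar N x (R x) + N x - normTrace N x * f x) (t := normTrace N x * g x - N (R x))
      (by linear_combination (norm := module) -hsq)
    exact ⟨sub_eq_zero.mp h.1, (sub_eq_zero.mp h.2).symm⟩
  refine ⟨f, g, hlin, sq_add, fun x ↦ (norms x).2, fun x ↦ ?_⟩
  rw [QuadraticMap.map_add N, polar_comm, (norms x).2]
  linear_combination (norms x).1

end Existence

namespace IsCoeffPair

theorem phi (h : IsCoeffPair N R f g) : IsCoeffPair N (phiRB 1 R) (-f) (f + g) where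
  linearIndependent := by
    rw [LinearIndependent.pair_iff]
    intro s t hst
    rw [phiRB_one_apply] at hst
    obtain ⟨hs, ht⟩ := h.linearIndependent.eq_zero_of_pair (s := -s) (t := t - s)
      (by linear_combination (norm := module) hst)
    exact ⟨neg_eq_zero.mp hs, by linear_combination ht - hs⟩
  sq_add x := by
    simp only [phiRB_one_apply, map_neg, map_add, LinearMap.neg_apply, LinearMap.add_apply]
    linear_combination (norm := module) h.sq_add x
  norm_map x := by
    rw [phiRB_one_apply, QuadraticMap.map_neg, h.norm_map_add, LinearMap.add_apply]
  norm_map_add x := by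
    rw [phiRB_one_apply, neg_add, neg_add_cancel_right, QuadraticMap.map_neg, h.norm_map]
    simp only [LinearMap.neg_apply, LinearMap.add_apply, neg_add_cancel_left]

theorem polar_map (h : IsCoeffPair N R f g) (x y : A) :
    polar N (R x) (R y) = normTrace N x * g y + normTrace N y * g x := by
  rw [polar, ← map_add, h.norm_map, h.norm_map, h.norm_map, map_add, map_add]
  ring

theorem polar_map_add (h : IsCoeffPair N R f g) (x y : A) :
    polar N (R x + x) (R y + y) =
      normTrace N x * (f y + g y) + normTrace N y * (f x + g x) := by
  rw [← neg_neg (R x + x), ← neg_neg (R y + y), ← phiRB_one_apply, ← phiRB_one_apply,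
    polar_neg_left, polar_neg_right, neg_neg, h.phi.polar_map, LinearMap.add_apply,
    LinearMap.add_apply]

theorem exists_map_eq_one (h : IsCoeffPair N R f g) (hg : g ≠ 0) : ∃ u, R u = 1 := by
  obtain ⟨x, hx⟩ := LinearMap.surjective hg 1
  refine ⟨f x • 1 - R x - x, ?_⟩
  have hsq := h.sq_add x
  rw [hx] at hsq
  rw [map_sub, map_sub, map_smul]
  linear_combination (norm := module) -hsq

theorem exists_map_add_eq_one (h : IsCoeffPair N R f g) (hfg : f + g ≠ 0) :
    ∃ v, R v + v = 1 := by
  obtain ⟨u, hu⟩ := h.phi.exists_map_eq_one hfg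
  refine ⟨-u, ?_⟩
  rw [phiRB_one_apply] at hu
  rw [map_neg, ← neg_add, hu]

theorem eq_zero_or_add_eq_zero [Nontrivial A] (h : IsCoeffPair N R f g)
    (hR : IsRotaBaxter (1 : F) R) : g = 0 ∨ f + g = 0 := by
  by_contra! hne
  obtain ⟨u, hu⟩ := h.exists_map_eq_one hne.1
  obtain ⟨v, hv⟩ := h.exists_map_add_eq_one hne.2
  exact hR.not_map_eq_one_and_map_add_eq_one hu hv

end IsCoeffPair

/-- The Rota-Baxter operators of weight `1` to which the non-splitting ones reduce: `R 1` is an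
idempotent of norm `0` and trace `1`, and `R ^ 2 + R` takes its values in its span. -/
structure IsPrimitiveRB (N : QuadraticForm F A) (R : A →ₗ[F] A) : Prop where
  isRotaBaxter : IsRotaBaxter (1 : F) R
  sq_add (x : A) : R (R x) + R x = polar N (R 1) x • R 1
  norm_map (x : A) : N (R x) = 0
  norm_map_add (x : A) : N (R x + x) = normTrace N x * polar N (R 1) x

variable [IsQuadraticNorm N]

namespace IsCoeffPair

theorem normTrace_eq_one (h : IsCoeffPair N R f 0) {v : A} (hv : R v + v = 1) :
    normTrace N v = 1 ∧ f v = 1 := by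
  have hsq := h.sq_add v
  rw [← map_add, hv, LinearMap.zero_apply] at hsq
  have hf : f v = 1 := by
    have hpair := h.linearIndependent.eq_zero_of_pair (s := 1 - f v) (t := 0)
      (by linear_combination (norm := module) hsq)
    linear_combination -hpair.1
  have hnorm := h.norm_map_add v
  rw [hv, IsQuadraticNorm.apply_one, hf, LinearMap.zero_apply] at hnorm
  exact ⟨by linear_combination -hnorm, hf⟩

theorem map_map_one (h : IsCoeffPair N R f 0) (hR : IsRotaBaxter (1 : F) R) (hf : f ≠ 0) :
    R (R 1) = 0 ∧ normTrace N (R 1) = 1 := by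
  obtain ⟨v, hv⟩ := h.exists_map_add_eq_one (by rwa [add_zero])
  obtain ⟨htv, hfv⟩ := h.normTrace_eq_one hv
  have htr : normTrace N (R 1) = f 1 := by
    have hpolar := h.polar_map_add 1 v
    rw [hv, ← normTrace_apply, map_add, normTrace_one, htv, hfv] at hpolar
    simp only [LinearMap.zero_apply] at hpolar
    linear_combination hpolar
  have hsq : R (R 1) = (f 1 - 1) • R 1 := by
    have hsq := h.sq_add 1
    rw [LinearMap.zero_apply] at hsq
    linear_combination (norm := module) hsq
  have htr' : normTrace N (R 1) = 2 * f 1 - 1 := by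
    have hmul := hR.map_mul_map 1 1
    rw [mul_self (N := N) (R 1), mul_one, one_mul, one_mul, h.norm_map, hsq,
      LinearMap.zero_apply] at hmul
    have hpair := h.linearIndependent.eq_zero_of_pair (s := normTrace N (R 1) - (2 * f 1 - 1))
      (t := 0) (by linear_combination (norm := module) hmul)
    linear_combination hpair.1
  have hf1 : f 1 = 1 := by linear_combination htr - htr'
  exact ⟨by rw [hsq, hf1, sub_self, zero_smul], htr.trans hf1⟩

theorem apply_eq_polar (h : IsCoeffPair N R f 0) (hR : IsRotaBaxter (1 : F) R) (hf : f ≠ 0)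
    (x : A) : f x = polar N (R 1) x := by
  obtain ⟨hR1, htr⟩ := h.map_map_one hR hf
  have hfR1 : f (R 1) = 0 := by
    have hsq := h.sq_add (R 1)
    rw [hR1, map_zero, LinearMap.zero_apply] at hsq
    exact (h.linearIndependent.eq_zero_of_pair (s := f (R 1)) (t := 0)
      (by linear_combination (norm := module) -hsq)).1
  have hpolar := h.polar_map_add (R 1) x
  rw [hR1, zero_add, polar_add_right, h.polar_map, htr, hfR1] at hpolar
  simp only [LinearMap.zero_apply] at hpolar
  linear_combination -hpolar

theorem isPrimitiveRB (h : IsCoeffPair N R f 0) (hR : IsRotaBaxter (1 : F) R) (hf : f ≠ 0) :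
    IsPrimitiveRB N R where
  isRotaBaxter := hR
  sq_add x := by
    rw [h.sq_add, h.apply_eq_polar hR hf, LinearMap.zero_apply, zero_smul, sub_zero]
  norm_map x := by rw [h.norm_map, LinearMap.zero_apply, mul_zero]
  norm_map_add x := by
    rw [h.norm_map_add, h.apply_eq_polar hR hf, LinearMap.zero_apply, add_zero]

end IsCoeffPair

theorem IsRotaBaxter.isPrimitiveRB_or [IsScalarTower F A A] [SMulCommClass F A A]
    (hR : IsRotaBaxter (1 : F) R) (htr : normTrace N ≠ 0) {x : A} (hx : R (R x) + R x ≠ 0) :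
    IsPrimitiveRB N R ∨ IsPrimitiveRB N (phiRB 1 R) := by
  have := nontrivial N
  have hlin : LinearIndependent F ![R 1, 1] := by
    rw [LinearIndependent.pair_symm_iff, LinearIndependent.pair_iff' one_ne_zero]
    exact fun c hc ↦ hx (hR.map_map_add_eq_zero_of_map_one_eq_smul hc.symm x)
  obtain ⟨f, g, h⟩ := hR.exists_isCoeffPair htr hlin
  have hf : f ≠ 0 ∨ g ≠ 0 := by
    by_contra! hfg
    rw [h.sq_add, hfg.1, hfg.2] at hx
    simp at hx
  rcases h.eq_zero_or_add_eq_zero hR with rfl | hfg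
  · exact .inl (h.isPrimitiveRB hR (hf.resolve_right (· rfl)))
  · have hφ := h.phi
    rw [hfg] at hφ
    refine .inr (hφ.isPrimitiveRB hR.phi (neg_ne_zero.mpr ?_))
    rintro rfl
    rw [zero_add] at hfg
    exact hf.elim (· rfl) (· hfg)

end WeightOne

section Peirce

variable {F A : Type*} [Field F] [NonAssocRing A] [Module F A]

open QuadraticMap IsQuadraticNorm IsAlternative

/-- Primitive idempotents of a quadratic algebra, described by their trace and norm. -/
structure IsPrimIdem (N : QuadraticForm F A) (e : A) : Prop where
  normTrace_eq_one : normTrace N e = 1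
  apply_eq_zero : N e = 0

variable {N : QuadraticForm F A} {e x y z : A}

namespace IsPrimIdem

theorem ne_zero (he : IsPrimIdem N e) : e ≠ 0 := by
  rintro rfl
  exact zero_ne_one ((map_zero _).symm.trans he.normTrace_eq_one)

theorem polar_self (he : IsPrimIdem N e) : polar N e e = 0 := by
  rw [QuadraticMap.polar_self, he.apply_eq_zero, smul_zero]

variable [IsQuadraticNorm N]

theorem one_sub (he : IsPrimIdem N e) : IsPrimIdem N (1 - e) where
  normTrace_eq_one := by
    rw [map_sub, normTrace_one, he.normTrace_eq_one]
    norm_num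
  apply_eq_zero := by
    rw [sub_eq_add_neg, QuadraticMap.map_add N, QuadraticMap.map_neg, polar_neg_right, polar_comm,
      ← normTrace_apply, IsQuadraticNorm.apply_one, he.normTrace_eq_one, he.apply_eq_zero]
    ring

theorem mul_self (he : IsPrimIdem N e) : e * e = e := by
  rw [IsQuadraticNorm.mul_self (N := N), he.normTrace_eq_one, he.apply_eq_zero, one_smul, zero_smul,
    sub_zero]

theorem linearIndependent [IsScalarTower F A A] (he : IsPrimIdem N e) :
    LinearIndependent F ![e, 1] := by
  rw [LinearIndependent.pair_iff]
  intro s t hst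
  have hadd : s + t = 0 := by
    have h := congrArg (· * e) hst
    simp only [add_mul, smul_mul_assoc, he.mul_self, one_mul, zero_mul, ← add_smul] at h
    exact (smul_eq_zero.mp h).resolve_right he.ne_zero
  have htr : s + t * 2 = 0 := by
    have h := congrArg (normTrace N) hst
    simpa only [map_add, map_smul, he.normTrace_eq_one, normTrace_one, smul_eq_mul, mul_one,
      map_zero] using h
  exact ⟨by linear_combination 2 * hadd - htr, by linear_combination htr - hadd⟩

end IsPrimIdem

variable [IsScalarTower F A A] [SMulCommClass F A A]

/-- The off-diagonal Peirce space `A₁₀(e)` of the idempotent `e`. The other one, `A₀₁(e)`, is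
`peirceSpace F (1 - e)`. -/
def peirceSpace (F : Type*) {A : Type*} [Field F] [NonAssocRing A] [Module F A]
    [IsScalarTower F A A] [SMulCommClass F A A] (e : A) : Submodule F A where
  carrier := {x | e * x = x ∧ x * e = 0}
  add_mem' hx hy := ⟨by rw [mul_add, hx.1, hy.1], by rw [add_mul, hx.2, hy.2, add_zero]⟩
  zero_mem' := ⟨mul_zero e, zero_mul e⟩
  smul_mem' c x hx := ⟨by rw [mul_smul_comm, hx.1], by rw [smul_mul_assoc, hx.2, smul_zero]⟩

theorem mem_peirceSpace_iff : x ∈ peirceSpace F e ↔ e * x = x ∧ x * e = 0 := Iff.rfl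

theorem mem_peirceSpace_one_sub_iff : x ∈ peirceSpace F (1 - e) ↔ e * x = 0 ∧ x * e = x := by
  rw [mem_peirceSpace_iff, sub_mul, mul_sub, one_mul, mul_one, sub_eq_self, sub_eq_zero,
    eq_comm (a := x)]

theorem mul_mem_peirceSpace_one_sub [IsAlternative A] (hx : x ∈ peirceSpace F e)
    (hy : y ∈ peirceSpace F e) : x * y ∈ peirceSpace F (1 - e) := by
  rw [mem_peirceSpace_one_sub_iff]
  constructor
  · have h := mul_mul_add e x y
    rwa [hy.1, hx.1, hx.2, add_zero, add_eq_right] at h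
  · have h := mul_add_mul_mul y e x
    rwa [hx.2, zero_mul, add_zero, hy.1, hy.2, zero_add] at h

namespace IsPrimIdem

variable [IsQuadraticNorm N]

theorem normTrace_eq_zero_and_polar_eq_zero (he : IsPrimIdem N e) (hx : x ∈ peirceSpace F e) :
    normTrace N x = 0 ∧ polar N e x = 0 := by
  have h := mul_add_mul N e x
  rw [hx.1, hx.2, he.normTrace_eq_one] at h
  have hpair := he.linearIndependent.eq_zero_of_pair (s := normTrace N x) (t := -polar N e x)
    (by linear_combination (norm := module) -h)
  exact ⟨hpair.1, neg_eq_zero.mp hpair.2⟩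

theorem polar_one_sub_eq_zero (he : IsPrimIdem N e) (hx : x ∈ peirceSpace F e) :
    polar N (1 - e) x = 0 := by
  obtain ⟨htr, hpolar⟩ := he.normTrace_eq_zero_and_polar_eq_zero hx
  rw [polar_sub_left, hpolar, polar_comm, ← normTrace_apply, htr, sub_zero]

theorem polar_eq_zero_of_mem_one_sub (he : IsPrimIdem N e) (hx : x ∈ peirceSpace F (1 - e)) :
    polar N e x = 0 := by
  simpa only [sub_sub_cancel] using he.one_sub.polar_one_sub_eq_zero hx

section Alternative

variable [IsAlternative A]

theorem apply_eq_zero_of_mem (he : IsPrimIdem N e) (hx : x ∈ peirceSpace F e) : N x = 0 := by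
  have h := mul_mul_left x e
  rw [hx.2, mul_zero, IsQuadraticNorm.mul_self (N := N) x,
    (he.normTrace_eq_zero_and_polar_eq_zero hx).1, zero_smul, zero_sub, neg_mul, smul_mul_assoc,
    one_mul, zero_eq_neg] at h
  exact (smul_eq_zero.mp h).resolve_right he.ne_zero

theorem mul_self_eq_zero (he : IsPrimIdem N e) (hx : x ∈ peirceSpace F e) : x * x = 0 := by
  rw [IsQuadraticNorm.mul_self (N := N) x, he.apply_eq_zero_of_mem hx,
    (he.normTrace_eq_zero_and_polar_eq_zero hx).1, zero_smul, zero_smul, sub_zero]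

theorem polar_eq_zero (he : IsPrimIdem N e) (hx : x ∈ peirceSpace F e) (hy : y ∈ peirceSpace F e) :
    polar N x y = 0 := by
  rw [polar, he.apply_eq_zero_of_mem (add_mem hx hy), he.apply_eq_zero_of_mem hx,
    he.apply_eq_zero_of_mem hy, sub_zero, sub_zero]

theorem mul_comm_eq_neg (he : IsPrimIdem N e) (hx : x ∈ peirceSpace F e)
    (hy : y ∈ peirceSpace F e) : y * x = -(x * y) := by
  have h := he.mul_self_eq_zero (add_mem hx hy)
  rw [add_mul, mul_add, mul_add, he.mul_self_eq_zero hx, he.mul_self_eq_zero hy, zero_add,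
    add_zero] at h
  exact eq_neg_of_add_eq_zero_right h

end Alternative

end IsPrimIdem

end Peirce

section PeirceProducts

variable {F A : Type*} [Field F] [NonAssocRing A] [Module F A] [IsScalarTower F A A]
  [SMulCommClass F A A] [IsAlternative A] {N : QuadraticForm F A} [IsQuadraticNorm N]
  {e u v w x y z : A}

open QuadraticMap IsQuadraticNorm IsAlternative

theorem mul_mem_peirceSpace (hx : x ∈ peirceSpace F (1 - e)) (hy : y ∈ peirceSpace F (1 - e)) :
    x * y ∈ peirceSpace F e := by
  simpa only [sub_sub_cancel] using mul_mem_peirceSpace_one_sub hx hy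

namespace IsPrimIdem

theorem mul_eq (he : IsPrimIdem N e) (hx : x ∈ peirceSpace F e)
    (hy : y ∈ peirceSpace F (1 - e)) : x * y = -polar N x y • e := by
  have hsum : x * y + y * x = -polar N x y • 1 := by
    rw [mul_add_mul N, (he.normTrace_eq_zero_and_polar_eq_zero hx).1,
      (he.one_sub.normTrace_eq_zero_and_polar_eq_zero hy).1]
    module
  rw [mem_peirceSpace_one_sub_iff] at hy
  have hxy : e * (x * y) = x * y := by
    have h := mul_mul_add e x y
    rwa [hy.1, mul_zero, add_zero, hx.1, hx.2, add_zero] at h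
  have hyx : e * (y * x) = 0 := by
    have h := mul_mul_add e y x
    rwa [hx.1, hy.1, hy.2, zero_add, add_eq_right] at h
  rw [← hxy, ← add_zero (e * (x * y)), ← hyx, ← mul_add, hsum, mul_smul_comm, mul_one]

theorem mul_eq' (he : IsPrimIdem N e) (hx : x ∈ peirceSpace F (1 - e))
    (hy : y ∈ peirceSpace F e) : x * y = -polar N x y • (1 - e) :=
  he.one_sub.mul_eq hx (by rwa [sub_sub_cancel])

theorem mul_mul_eq (he : IsPrimIdem N e) (hx : x ∈ peirceSpace F e) (hy : y ∈ peirceSpace F e)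
    (hz : z ∈ peirceSpace F (1 - e)) : x * y * z = polar N x z • y - polar N y z • x := by
  have h := mul_add_mul_mul y z x
  rw [he.mul_eq hx hz, mul_add, he.mul_eq hy hz, he.mul_eq' hz hy, smul_mul_assoc, hy.1,
    ← mul_add, polar_comm N z y, ← smul_add, add_sub_cancel, mul_smul_comm, mul_one] at h
  linear_combination (norm := module) h

theorem mul_mul_eq' (he : IsPrimIdem N e) (hx : x ∈ peirceSpace F e) (hy : y ∈ peirceSpace F e)
    (hz : z ∈ peirceSpace F (1 - e)) : z * (x * y) = polar N y z • x - polar N x z • y := by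
  have h := mul_mul_add z x y
  rw [he.mul_eq' hz hx, he.mul_eq' hz hy, he.mul_eq hx hz, mul_smul_comm, mul_sub, mul_one, hx.2,
    sub_zero, polar_comm N z x, polar_comm N z y, ← smul_add, sub_add_cancel, smul_mul_assoc,
    one_mul] at h
  linear_combination (norm := module) h

theorem polar_self_mul (he : IsPrimIdem N e) (hx : x ∈ peirceSpace F e)
    (hy : y ∈ peirceSpace F e) : polar N x (x * y) = 0 := by
  have h := he.mul_eq hx (mul_mem_peirceSpace_one_sub hx hy)
  rw [mul_mul_left, he.mul_self_eq_zero hx, zero_mul] at h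
  exact neg_eq_zero.mp ((smul_eq_zero.mp h.symm).resolve_right he.ne_zero)

theorem polar_mul_cyclic (he : IsPrimIdem N e) (hx : x ∈ peirceSpace F e)
    (hy : y ∈ peirceSpace F e) (hz : z ∈ peirceSpace F e) :
    polar N x (y * z) = polar N y (z * x) := by
  have h := he.polar_self_mul (add_mem hx hy) hz
  rw [add_mul, polar_add_left, polar_add_right, polar_add_right, he.polar_self_mul hx hz,
    he.polar_self_mul hy hz, zero_add, add_zero] at h
  rw [he.mul_comm_eq_neg hx hz, polar_neg_right]
  exact eq_neg_of_add_eq_zero_left h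

theorem peirce_mul_peirce (he : IsPrimIdem N e) (hu : u ∈ peirceSpace F e)
    (hv : v ∈ peirceSpace F (1 - e)) (hx : x ∈ peirceSpace F e)
    (hy : y ∈ peirceSpace F (1 - e)) (α β γ δ : F) :
    (α • e + β • (1 - e) + u + v) * (γ • e + δ • (1 - e) + x + y) =
      (α * γ - polar N u y) • e + (β * δ - polar N v x) • (1 - e) +
        (α • x + δ • u + v * y) + (β • y + γ • v + u * x) := by
  have huy := he.mul_eq hu hy
  have hvx := he.mul_eq' hv hx
  rw [mem_peirceSpace_one_sub_iff] at hv hy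
  simp only [add_mul, mul_add, smul_mul_assoc, mul_smul_comm, sub_mul, mul_sub, one_mul, mul_one,
    he.mul_self, hu.2, hv.2, hx.1, hy.1, huy, hvx]
  module

theorem exists_peirce (he : IsPrimIdem N e) (p : A) : ∃ x ∈ peirceSpace F e,
    ∃ y ∈ peirceSpace F (1 - e), p = polar N (1 - e) p • e + polar N e p • (1 - e) + x + y := by
  have hsum := mul_add_mul N p e
  rw [he.normTrace_eq_one, one_smul, polar_comm] at hsum
  have hpe : e * (p * e) = polar N (1 - e) p • e := by
    have h := congrArg (e * ·) hsum
    simp only [mul_add, mul_sub, mul_smul_comm, mul_mul_left e p, he.mul_self, mul_one] at h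
    rw [polar_sub_left, polar_comm N 1, ← normTrace_apply]
    linear_combination (norm := module) h
  have hep : e * p * e = polar N (1 - e) p • e := by rw [flexible, hpe]
  refine ⟨e * p - polar N (1 - e) p • e, ⟨?_, ?_⟩, p * e - polar N (1 - e) p • e,
    mem_peirceSpace_one_sub_iff.mpr ⟨?_, ?_⟩, ?_⟩
  · rw [mul_sub, mul_mul_left, mul_smul_comm, he.mul_self]
  · rw [sub_mul, hep, smul_mul_assoc, he.mul_self, sub_self]
  · rw [mul_sub, hpe, mul_smul_comm, he.mul_self, sub_self]
  · rw [sub_mul, mul_mul_right, smul_mul_assoc, he.mul_self]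
  · rw [polar_sub_left, polar_comm N 1, ← normTrace_apply]
    linear_combination (norm := module) -hsum

theorem exists_polar_eq_one (he : IsPrimIdem N e) (hN : N.polarBilin.SeparatingLeft)
    (hx : x ∈ peirceSpace F e) (hx0 : x ≠ 0) : ∃ y ∈ peirceSpace F (1 - e), polar N x y = 1 := by
  obtain ⟨p, hp⟩ : ∃ p, polar N x p ≠ 0 := by
    by_contra! h
    exact hx0 (hN x h)
  obtain ⟨z, hz, y, hy, hpe⟩ := he.exists_peirce p
  have hxp : polar N x p = polar N x y := by
    rw [hpe, polar_add_right, polar_add_right, polar_add_right, polar_smul_right, polar_smul_right,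
      polar_comm N x e, polar_comm N x (1 - e), he.polar_one_sub_eq_zero hx,
      (he.normTrace_eq_zero_and_polar_eq_zero hx).2, he.polar_eq_zero hx hz, smul_zero, smul_zero,
      add_zero, add_zero, zero_add]
  refine ⟨(polar N x p)⁻¹ • y, Submodule.smul_mem _ _ hy, ?_⟩
  rw [polar_smul_right, ← hxp, smul_eq_mul, inv_mul_cancel₀ hp]

theorem exists_le_span_singleton (he : IsPrimIdem N e) (hN : N.polarBilin.SeparatingLeft)
    (hmul : ∀ x ∈ peirceSpace F e, ∀ y ∈ peirceSpace F e, x * y = 0) :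
    ∃ a b, peirceSpace F e ≤ F ∙ a ∧ peirceSpace F (1 - e) ≤ F ∙ b := by
  rcases eq_or_ne (peirceSpace F e) ⊥ with hbot | hbot
  · refine ⟨0, 0, hbot.trans_le bot_le, fun w hw ↦ ?_⟩
    rw [Submodule.span_zero_singleton, Submodule.mem_bot]
    by_contra hw0
    obtain ⟨x, hx, hwx⟩ := he.one_sub.exists_polar_eq_one hN hw hw0
    rw [sub_sub_cancel, hbot, Submodule.mem_bot] at hx
    rw [hx, polar_zero_right] at hwx
    exact zero_ne_one hwx
  obtain ⟨a, ha, ha0⟩ := Submodule.exists_mem_ne_zero_of_ne_bot hbot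
  obtain ⟨b, hb, hab⟩ := he.exists_polar_eq_one hN ha ha0
  have hspan : ∀ x ∈ peirceSpace F e, x = polar N x b • a := fun x hx ↦ by
    have h := he.mul_mul_eq ha hx hb
    rwa [hmul a ha x hx, zero_mul, hab, one_smul, eq_comm, sub_eq_zero] at h
  have hmul' : ∀ w ∈ peirceSpace F (1 - e), b * w = 0 := fun w hw ↦ by
    rw [hspan _ (mul_mem_peirceSpace hb hw), polar_comm, he.one_sub.polar_self_mul hb hw, zero_smul]
  refine ⟨a, b, fun x hx ↦ Submodule.mem_span_singleton.mpr ⟨_, (hspan x hx).symm⟩,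
    fun w hw ↦ Submodule.mem_span_singleton.mpr ⟨polar N w a, ?_⟩⟩
  have h := he.one_sub.mul_mul_eq hb hw (z := a) (by rwa [sub_sub_cancel])
  rw [hmul' w hw, zero_mul, polar_comm N b, hab, one_smul, eq_comm, sub_eq_zero] at h
  exact h.symm

theorem exists_mul_ne_zero (he : IsPrimIdem N e) (hN : N.polarBilin.SeparatingLeft)
    (hrank : 4 < Module.finrank F A) :
    ∃ x ∈ peirceSpace F e, ∃ y ∈ peirceSpace F e, x * y ≠ 0 := by
  by_contra! hmul
  obtain ⟨a, b, ha, hb⟩ := he.exists_le_span_singleton hN hmul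
  have hspan : Submodule.span F (Set.range ![e, 1 - e, a, b]) = ⊤ := by
    refine eq_top_iff.mpr fun p _ ↦ ?_
    have hmem (i : Fin 4) :=
      Submodule.subset_span (R := F) (Set.mem_range_self (f := ![e, 1 - e, a, b]) i)
    obtain ⟨x, hx, y, hy, hp⟩ := he.exists_peirce p
    rw [hp]
    exact add_mem (add_mem (add_mem (Submodule.smul_mem _ _ (hmem 0))
      (Submodule.smul_mem _ _ (hmem 1)))
      ((Submodule.span_singleton_le_iff_mem _ _).mpr (hmem 2) (ha hx)))
      ((Submodule.span_singleton_le_iff_mem _ _).mpr (hmem 3) (hb hy))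
  have := finrank_range_le_card (R := F) ![e, 1 - e, a, b]
  rw [Set.finrank, hspan, finrank_top, Fintype.card_fin] at this
  omega

end IsPrimIdem

end PeirceProducts

section Frame

variable {F A : Type*} [Field F] [NonAssocRing A] [Module F A]

open QuadraticMap IsQuadraticNorm IsAlternative Matrix

/-- The three products `v₁v₂, v₂v₀, v₀v₁`. If `v` is a frame of `A₁₀(e)` (see `IsFrame`), they form
the dual basis of `A₀₁(e)` for the polar form of the norm. -/
def dualFrame (v : Fin 3 → A) (i : Fin 3) : A :=
  v (i + 1) * v (i + 2)

variable [IsScalarTower F A A] [SMulCommClass F A A]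

/-- A frame of the Peirce space `A₁₀(e)`: three vectors on which the alternating trilinear form
`(x, y, z) ↦ polar N x (y * z)` takes the value `1`. -/
structure IsFrame (N : QuadraticForm F A) (e : A) (v : Fin 3 → A) : Prop where
  isPrimIdem : IsPrimIdem N e
  mem (i : Fin 3) : v i ∈ peirceSpace F e
  polar_dualFrame_self (i : Fin 3) : polar N (v i) (dualFrame v i) = 1

variable {N : QuadraticForm F A} {e x : A} {v : Fin 3 → A}

namespace IsFrame

theorem linearCombination_mem (hv : IsFrame N e v) (p : Fin 3 → F) :
    Fintype.linearCombination F v p ∈ peirceSpace F e := by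
  rw [Fintype.linearCombination_apply]
  exact sum_mem fun i _ ↦ Submodule.smul_mem _ _ (hv.mem i)

variable [IsAlternative A]

theorem dualFrame_mem (hv : IsFrame N e v) (i : Fin 3) : dualFrame v i ∈ peirceSpace F (1 - e) :=
  mul_mem_peirceSpace_one_sub (hv.mem _) (hv.mem _)

end IsFrame

variable [IsAlternative A] [IsQuadraticNorm N]

theorem IsPrimIdem.isFrame (he : IsPrimIdem N e) {a b c : A} (ha : a ∈ peirceSpace F e)
    (hb : b ∈ peirceSpace F e) (hc : c ∈ peirceSpace F e) (habc : polar N a (b * c) = 1) :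
    IsFrame N e ![a, b, c] where
  isPrimIdem := he
  mem i := by fin_cases i <;> assumption
  polar_dualFrame_self i := by
    have hbca := he.polar_mul_cyclic ha hb hc
    have hcab := he.polar_mul_cyclic hb hc ha
    fin_cases i
    · exact habc
    · exact hbca.symm.trans habc
    · exact hcab.symm.trans (hbca.symm.trans habc)

namespace IsFrame

theorem polar_dualFrame (hv : IsFrame N e v) (i j : Fin 3) :
    polar N (v i) (dualFrame v j) = (1 : Matrix (Fin 3) (Fin 3) F) i j := by
  have hleft (k : Fin 3) : polar N (v (k + 1)) (dualFrame v k) = 0 :=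
    hv.isPrimIdem.polar_self_mul (hv.mem _) (hv.mem _)
  have hright (k : Fin 3) : polar N (v (k + 2)) (dualFrame v k) = 0 := by
    rw [dualFrame, hv.isPrimIdem.mul_comm_eq_neg (hv.mem (k + 2)) (hv.mem (k + 1)),
      polar_neg_right, hv.isPrimIdem.polar_self_mul (hv.mem _) (hv.mem _), neg_zero]
  obtain rfl | rfl | rfl : i = j ∨ i = j + 1 ∨ i = j + 2 := by omega
  · rw [Matrix.one_apply_eq, hv.polar_dualFrame_self]
  · rw [Matrix.one_apply_ne (by simp), hleft]
  · rw [Matrix.one_apply_ne (by simp), hright]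

theorem dualFrame_dualFrame (hv : IsFrame N e v) : dualFrame (dualFrame v) = v := by
  funext i
  have h := hv.isPrimIdem.mul_mul_eq' (hv.mem i) (hv.mem (i + 1)) (hv.dualFrame_mem (i + 1))
  rw [hv.polar_dualFrame_self, hv.polar_dualFrame, Matrix.one_apply_ne (by simp), one_smul,
    zero_smul, sub_zero] at h
  have hi : i + 2 + 1 = i := by omega
  have hi' : i + 2 + 2 = i + 1 := by omega
  have hdual : dualFrame v (i + 2) = v i * v (i + 1) := by rw [dualFrame, hi, hi']
  rwa [dualFrame, hdual]

theorem dual (hv : IsFrame N e v) : IsFrame N (1 - e) (dualFrame v) where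
  isPrimIdem := hv.isPrimIdem.one_sub
  mem := hv.dualFrame_mem
  polar_dualFrame_self i := by
    rw [hv.dualFrame_dualFrame, polar_comm, hv.polar_dualFrame_self]

theorem eq_linearCombination (hv : IsFrame N e v) (hx : x ∈ peirceSpace F e) :
    x = Fintype.linearCombination F v (fun i ↦ polar N x (dualFrame v i)) := by
  have he := hv.isPrimIdem
  have hxv := mul_mem_peirceSpace_one_sub hx (hv.mem 0)
  have h₁ : polar N (v 1) (x * v 0) = polar N x (dualFrame v 2) :=
    he.polar_mul_cyclic (hv.mem 1) hx (hv.mem 0)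
  have h₂ : polar N (v 2) (x * v 0) = -polar N x (dualFrame v 1) := by
    rw [he.polar_mul_cyclic (hv.mem 2) hx (hv.mem 0), he.mul_comm_eq_neg (hv.mem 2) (hv.mem 0),
      polar_neg_right]
    rfl
  have hdual : dualFrame v 0 = v 1 * v 2 := rfl
  have h := he.mul_mul_eq' hx (hv.mem 0) (hv.dualFrame_mem 0)
  rw [he.one_sub.mul_comm_eq_neg hxv (hv.dualFrame_mem 0), hv.polar_dualFrame_self,
    hdual, he.mul_mul_eq' (hv.mem 1) (hv.mem 2) hxv, h₁, h₂, ← hdual] at h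
  rw [Fintype.linearCombination_apply, Fin.sum_univ_three]
  linear_combination (norm := module) -h

theorem polar_linearCombination (hv : IsFrame N e v) (p q : Fin 3 → F) :
    polar N (Fintype.linearCombination F v p) (Fintype.linearCombination F (dualFrame v) q) =
      p ⬝ᵥ q := by
  simp only [Fintype.linearCombination_apply, ← polarBilin_apply_apply, map_sum, map_smul,
    LinearMap.sum_apply, LinearMap.smul_apply]
  simp only [polarBilin_apply_apply, hv.polar_dualFrame, Matrix.one_apply, smul_eq_mul, mul_ite,
    mul_one, mul_zero, Finset.sum_ite_eq', Finset.mem_univ, if_true, dotProduct,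
    mul_comm]

theorem linearCombination_mul (hv : IsFrame N e v) (p q : Fin 3 → F) :
    Fintype.linearCombination F v p * Fintype.linearCombination F v q =
      Fintype.linearCombination F (dualFrame v) (p ⨯₃ q) := by
  have hself (i) := hv.isPrimIdem.mul_self_eq_zero (hv.mem i)
  have hcomm (i j) := hv.isPrimIdem.mul_comm_eq_neg (hv.mem i) (hv.mem j)
  simp only [Fintype.linearCombination_apply, Fin.sum_univ_three, add_mul, mul_add, smul_mul_assoc,
    mul_smul_comm, hself, hcomm 0 1, hcomm 1 2, hcomm 2 0, cross_apply, dualFrame]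
  simp only [smul_zero, smul_neg, zero_add, smul_add, add_zero, cons_val, Fin.reduceAdd]
  module

end IsFrame

end Frame

namespace SplitOctonion

variable {F : Type*} [Field F]

open Matrix QuadraticMap

theorem sympInv_eq_adjugate (a : Matrix (Fin 2) (Fin 2) F) : sympInv a = a.adjugate :=
  (adjugate_fin_two a).symm

theorem sympInv_mul_self (a : Matrix (Fin 2) (Fin 2) F) : sympInv a * a = a.det • 1 := by
  rw [sympInv_eq_adjugate, adjugate_mul]

theorem mul_sympInv_self (a : Matrix (Fin 2) (Fin 2) F) : a * sympInv a = a.det • 1 := by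
  rw [sympInv_eq_adjugate, mul_adjugate]

theorem sympInv_mul (a b : Matrix (Fin 2) (Fin 2) F) :
    sympInv (a * b) = sympInv b * sympInv a := by
  rw [sympInv_eq_adjugate, adjugate_mul_distrib, ← sympInv_eq_adjugate, ← sympInv_eq_adjugate]

theorem sympInv_sympInv (a : Matrix (Fin 2) (Fin 2) F) : sympInv (sympInv a) = a := by
  rw [sympInv_eq_adjugate, sympInv_eq_adjugate, adjugate_adjugate _ (by simp)]
  simp

theorem sympInv_transpose (a : Matrix (Fin 2) (Fin 2) F) : sympInv aᵀ = (sympInv a)ᵀ := by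
  rw [sympInv_eq_adjugate, sympInv_eq_adjugate, adjugate_transpose]

theorem sympInv_eq_trace_smul_sub (a : Matrix (Fin 2) (Fin 2) F) :
    sympInv a = a.trace • 1 - a := by
  ext i j
  fin_cases i <;> fin_cases j <;> simp [sympInv, trace_fin_two]

theorem sympInv_one : sympInv (1 : Matrix (Fin 2) (Fin 2) F) = 1 := by
  rw [sympInv_eq_adjugate, adjugate_one]

/-- The split octonions as a unital ring. It is made an instance only locally: a global one would be
a second path to their addition and multiplication. -/
@[reducible] def nonAssocRing : NonAssocRing (SplitOctonion F) where
  one := ⟨1, 0⟩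
  one_mul x := by
    change (⟨1, 0⟩ : SplitOctonion F) * x = x
    ext1 <;> simp [sympInv_zero, sympInv_one]
  mul_one x := by
    change x * (⟨1, 0⟩ : SplitOctonion F) = x
    ext1 <;> simp

attribute [local instance] nonAssocRing

@[simp] theorem one_m : (1 : SplitOctonion F).m = 1 := rfl

@[simp] theorem one_w : (1 : SplitOctonion F).w = 0 := rfl

/-- The transposition `a + vb ↦ aᵀ + v(b̄ᵀ)`, an anti-automorphism exchanging `e₁₂` and `e₂₁`. -/
def transpose : SplitOctonion F ≃ₗ[F] SplitOctonion F where
  toFun x := ⟨x.mᵀ, (sympInv x.w)ᵀ⟩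
  invFun x := ⟨x.mᵀ, (sympInv x.w)ᵀ⟩
  map_add' x y := by ext1 <;> simp [sympInv_add]
  map_smul' c x := by ext1 <;> simp [sympInv_smul]
  left_inv x := by ext1 <;> simp [sympInv_transpose, sympInv_sympInv]
  right_inv x := by ext1 <;> simp [sympInv_transpose, sympInv_sympInv]

theorem transpose_mul (x y : SplitOctonion F) :
    transpose (x * y) = transpose y * transpose x := by
  ext1 <;> simp [transpose, sympInv_transpose, sympInv_sympInv, sympInv_add, sympInv_mul, add_comm]

theorem mul_mul_left (x y : SplitOctonion F) : x * (x * y) = x * x * y := by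
  have hm := sympInv_eq_trace_smul_sub x.m
  have hw := mul_sympInv_self x.w
  have hw' := sympInv_mul_self x.w
  ext1 <;> simp only [mul_m, mul_w, sympInv_add, sympInv_mul, sympInv_sympInv] <;>
    simp only [hm, hw, hw', mul_add, add_mul, mul_sub, sub_mul, smul_mul_assoc, mul_smul_comm,
      one_mul, mul_one, Matrix.mul_assoc] <;>
    module

instance : IsAlternative (SplitOctonion F) where
  mul_mul_left := mul_mul_left
  mul_mul_right x y := transpose.injective <| by
    simp only [transpose_mul, mul_mul_left]

/-- The norm `m + vw ↦ det m - det w` of the split Cayley-Dickson algebra. -/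
def norm : QuadraticForm F (SplitOctonion F) :=
  QuadraticMap.ofPolar (fun x ↦ x.m.det - x.w.det)
    (fun c x ↦ by simp only [smul_m, smul_w, det_smul, Fintype.card_fin, smul_eq_mul]; ring)
    (fun x y z ↦ by simp only [polar, det_fin_two, add_m, add_w, Matrix.add_apply]; ring)
    (fun c x y ↦ by
      simp only [polar, det_fin_two, add_m, add_w, smul_m, smul_w, Matrix.add_apply,
        Matrix.smul_apply, smul_eq_mul]
      ring)

theorem norm_apply (x : SplitOctonion F) : norm x = x.m.det - x.w.det := rfl

theorem polar_norm (x y : SplitOctonion F) : polar norm x y =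
    x.m 0 0 * y.m 1 1 + x.m 1 1 * y.m 0 0 - x.m 0 1 * y.m 1 0 - x.m 1 0 * y.m 0 1 -
      (x.w 0 0 * y.w 1 1 + x.w 1 1 * y.w 0 0 - x.w 0 1 * y.w 1 0 - x.w 1 0 * y.w 0 1) := by
  simp only [polar, norm_apply, det_fin_two, add_m, add_w, Matrix.add_apply]
  ring

theorem normTrace_norm (x : SplitOctonion F) : normTrace norm x = x.m.trace := by
  simp [normTrace_apply, polar_norm, trace_fin_two]

instance : IsQuadraticNorm (norm (F := F)) where
  apply_one := by simp [norm_apply]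
  mul_self x := by
    have hm := sympInv_mul_self x.m
    rw [sympInv_eq_trace_smul_sub, sub_mul, smul_mul_assoc, one_mul] at hm
    rw [normTrace_norm, norm_apply]
    ext1
    · simp only [mul_m, mul_sympInv_self, sub_m, smul_m, one_m]
      linear_combination (norm := module) -hm
    · simp only [mul_w, sympInv_eq_trace_smul_sub, sub_mul, smul_mul_assoc, one_mul, sub_w, smul_w,
        one_w]
      module

theorem separatingLeft_norm : (norm (F := F)).polarBilin.SeparatingLeft := by
  intro x hx
  replace hx (y : SplitOctonion F) := (polar_norm x y).symm.trans (hx y)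
  ext i j <;> fin_cases i <;> fin_cases j
  · simpa using hx ⟨single 1 1 1, 0⟩
  · simpa using hx ⟨single 1 0 1, 0⟩
  · simpa using hx ⟨single 0 1 1, 0⟩
  · simpa using hx ⟨single 0 0 1, 0⟩
  · simpa using hx ⟨0, single 1 1 1⟩
  · simpa using hx ⟨0, single 1 0 1⟩
  · simpa using hx ⟨0, single 0 1 1⟩
  · simpa using hx ⟨0, single 0 0 1⟩

theorem finrank_eq : Module.finrank F (SplitOctonion F) = 8 := by
  let toProd : SplitOctonion F ≃ₗ[F] Matrix (Fin 2) (Fin 2) F × Matrix (Fin 2) (Fin 2) F :=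
    { toFun := fun x ↦ (x.m, x.w)
      invFun := fun p ↦ ⟨p.1, p.2⟩
      map_add' := fun _ _ ↦ rfl
      map_smul' := fun _ _ ↦ rfl }
  rw [toProd.finrank_eq, Module.finrank_prod, Module.finrank_matrix]
  simp

end SplitOctonion

section FrameMap

attribute [local instance] SplitOctonion.nonAssocRing

namespace SplitOctonion

variable {F : Type*} [Field F]

open Matrix

/-- The coordinates of the component of an octonion in the Peirce space `A₁₀(e₁₁)`, with respect to
the frame `e₁₂, ve₂₁, ve₂₂`. -/
def upper : SplitOctonion F →ₗ[F] Fin 3 → F where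
  toFun x := ![x.m 0 1, x.w 1 0, x.w 1 1]
  map_add' x y := by simp
  map_smul' c x := by simp

/-- The coordinates of the component of an octonion in the Peirce space `A₀₁(e₁₁)`, with respect to
the dual frame `-e₂₁, ve₁₂, -ve₁₁`. -/
def lower : SplitOctonion F →ₗ[F] Fin 3 → F where
  toFun x := ![-x.m 1 0, x.w 0 1, -x.w 0 0]
  map_add' x y := by simp [add_comm]
  map_smul' c x := by simp

theorem upper_apply (x : SplitOctonion F) : upper x = ![x.m 0 1, x.w 1 0, x.w 1 1] := rfl

theorem lower_apply (x : SplitOctonion F) : lower x = ![-x.m 1 0, x.w 0 1, -x.w 0 0] := rfl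

variable (x y : SplitOctonion F)

theorem mul_m_zero_zero : (x * y).m 0 0 = x.m 0 0 * y.m 0 0 - upper x ⬝ᵥ lower y := by
  simp only [upper_apply, lower_apply, mul_m, Matrix.add_apply, mul_apply, Fin.sum_univ_two,
    sympInv, vec3_dotProduct, of_apply, cons_val]
  ring

theorem mul_m_one_one : (x * y).m 1 1 = x.m 1 1 * y.m 1 1 - lower x ⬝ᵥ upper y := by
  simp only [upper_apply, lower_apply, mul_m, Matrix.add_apply, mul_apply, Fin.sum_univ_two,
    sympInv, vec3_dotProduct, of_apply, cons_val]
  ring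

theorem upper_mul :
    upper (x * y) = x.m 0 0 • upper y + y.m 1 1 • upper x + lower x ⨯₃ lower y := by
  simp only [upper_apply, lower_apply, mul_m, mul_w, Matrix.add_apply, mul_apply, Fin.sum_univ_two,
    sympInv, cross_apply, of_apply, cons_val, smul_cons, smul_empty, smul_eq_mul, cons_add_cons,
    empty_add_empty, vecCons_inj]
  refine ⟨?_, ?_, ?_, trivial⟩ <;> ring

theorem lower_mul :
    lower (x * y) = x.m 1 1 • lower y + y.m 0 0 • lower x + upper x ⨯₃ upper y := by
  simp only [upper_apply, lower_apply, mul_m, mul_w, Matrix.add_apply, mul_apply, Fin.sum_univ_two,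
    sympInv, cross_apply, of_apply, cons_val, smul_cons, smul_empty, smul_eq_mul, cons_add_cons,
    empty_add_empty, vecCons_inj]
  refine ⟨?_, ?_, ?_, trivial⟩ <;> ring

end SplitOctonion

variable {F A : Type*} [Field F] [NonAssocRing A] [Module F A]

open QuadraticMap IsQuadraticNorm SplitOctonion Matrix

/-- The linear map from the split octonions that carries `e₁₁` to `e`, the unit to the unit, and the
standard frame of `A₁₀(e₁₁)` and its dual to `v` and its dual. -/
def frameMap (e : A) (v : Fin 3 → A) : SplitOctonion F →ₗ[F] A where
  toFun x := x.m 0 0 • e + x.m 1 1 • (1 - e) + Fintype.linearCombination F v (upper x) +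
    Fintype.linearCombination F (dualFrame v) (lower x)
  map_add' x y := by
    simp only [add_m, Matrix.add_apply, map_add]
    module
  map_smul' c x := by
    simp only [smul_m, Matrix.smul_apply, smul_eq_mul, map_smul, RingHom.id_apply]
    module

theorem frameMap_apply (e : A) (v : Fin 3 → A) (x : SplitOctonion F) :
    frameMap e v x = x.m 0 0 • e + x.m 1 1 • (1 - e) + Fintype.linearCombination F v (upper x) +
      Fintype.linearCombination F (dualFrame v) (lower x) := rfl

theorem frameMap_one (e : A) (v : Fin 3 → A) : frameMap e v (1 : SplitOctonion F) = 1 := by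
  simp [frameMap_apply, upper_apply, lower_apply, Fintype.linearCombination_apply,
    Fin.sum_univ_three]

variable [IsScalarTower F A A] [SMulCommClass F A A] [IsAlternative A] {N : QuadraticForm F A}
  [IsQuadraticNorm N] {e : A} {v : Fin 3 → A}

namespace IsFrame

theorem frameMap_mul (hv : IsFrame N e v) (x y : SplitOctonion F) :
    frameMap e v (x * y) = frameMap e v x * frameMap e v y := by
  have hupper := hv.linearCombination_mem
  have hlower := hv.dual.linearCombination_mem
  rw [frameMap_apply, frameMap_apply, frameMap_apply, hv.isPrimIdem.peirce_mul_peirce (hupper _)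
    (hlower _) (hupper _) (hlower _), hv.polar_linearCombination, polar_comm,
    hv.polar_linearCombination, hv.linearCombination_mul, hv.dual.linearCombination_mul,
    hv.dualFrame_dualFrame, mul_m_zero_zero, mul_m_one_one, upper_mul, lower_mul, dotProduct_comm]
  simp only [map_add, map_smul]
  rw [dotProduct_comm (lower x)]

theorem frameMap_injective (hv : IsFrame N e v) :
    Function.Injective (frameMap e v : SplitOctonion F →ₗ[F] A) := by
  rw [injective_iff_map_eq_zero]
  intro x hx
  have hpolar (y : SplitOctonion F) :
      normTrace SplitOctonion.norm x • frameMap e v y =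
        polar SplitOctonion.norm x y • (1 : A) := by
    have h := congrArg (frameMap e v) (mul_add_mul SplitOctonion.norm x y)
    simp only [map_add, map_sub, map_smul, hv.frameMap_mul, hx, frameMap_one, zero_mul,
      mul_zero, smul_zero] at h
    linear_combination (norm := module) -h
  have htr : normTrace SplitOctonion.norm x = 0 := by
    have h := hpolar ⟨single 0 0 1, 0⟩
    have he : frameMap (F := F) e v ⟨single 0 0 1, 0⟩ = e := by
      simp [frameMap_apply, upper_apply, lower_apply, Fintype.linearCombination_apply,
        Fin.sum_univ_three]
    rw [he, ← sub_eq_zero, sub_eq_add_neg, ← neg_smul] at h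
    exact (hv.isPrimIdem.linearIndependent.eq_zero_of_pair h).1
  refine separatingLeft_norm x fun y ↦ ?_
  have := IsQuadraticNorm.nontrivial N
  have h := hpolar y
  rwa [htr, zero_smul, eq_comm, smul_eq_zero_iff_left one_ne_zero] at h

theorem frameMap_surjective (hv : IsFrame N e v) :
    Function.Surjective (frameMap e v : SplitOctonion F →ₗ[F] A) := by
  intro a
  obtain ⟨x, hx, y, hy, ha⟩ := hv.isPrimIdem.exists_peirce a
  have hx' := hv.eq_linearCombination hx
  have hy' := hv.dual.eq_linearCombination hy
  set p : Fin 3 → F := fun i ↦ polar N x (dualFrame v i)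
  set q : Fin 3 → F := fun i ↦ polar N y (dualFrame (dualFrame v) i)
  refine ⟨⟨!![polar N (1 - e) a, p 0; -q 0, polar N e a], !![-q 2, q 1; p 1, p 2]⟩, ?_⟩
  have hp : upper ⟨!![polar N (1 - e) a, p 0; -q 0, polar N e a], !![-q 2, q 1; p 1, p 2]⟩ = p := by
    ext i; fin_cases i <;> rfl
  have hq : lower ⟨!![polar N (1 - e) a, p 0; -q 0, polar N e a], !![-q 2, q 1; p 1, p 2]⟩ = q := by
    ext i; fin_cases i <;> simp [lower_apply]
  rw [frameMap_apply, hp, hq, ← hx', ← hy']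
  exact ha.symm

/-- The isomorphism with the split octonions attached to a frame. -/
noncomputable def frameEquiv (hv : IsFrame N e v) : SplitOctonion F ≃ₗ[F] A :=
  LinearEquiv.ofBijective (frameMap e v) ⟨hv.frameMap_injective, hv.frameMap_surjective⟩

theorem frameEquiv_apply (hv : IsFrame N e v) (x : SplitOctonion F) :
    hv.frameEquiv x = frameMap e v x := rfl

theorem frameEquiv_symm_mul (hv : IsFrame N e v) (x y : A) :
    hv.frameEquiv.symm (x * y) = hv.frameEquiv.symm x * hv.frameEquiv.symm y := by
  apply hv.frameEquiv.injective
  rw [hv.frameEquiv_apply (_ * _), hv.frameMap_mul, ← hv.frameEquiv_apply, ← hv.frameEquiv_apply]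
  simp only [LinearEquiv.apply_symm_apply]

end IsFrame

end FrameMap

section NormalForm

variable {F A : Type*} [Field F] [NonAssocRing A] [Module F A] {N : QuadraticForm F A}
  {R : A →ₗ[F] A} {x y z : A}

open QuadraticMap IsQuadraticNorm SplitOctonion

namespace IsPrimitiveRB

theorem polar_map_map (h : IsPrimitiveRB N R) (x y : A) : polar N (R x) (R y) = 0 := by
  rw [polar, ← map_add, h.norm_map, h.norm_map, h.norm_map, sub_zero, sub_zero]

theorem polar_map_add_polar_map (h : IsPrimitiveRB N R) (x y : A) :
    polar N (R x) y + polar N x (R y) + polar N x y =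
      normTrace N x * polar N (R 1) y + normTrace N y * polar N (R 1) x := by
  have hpolar : polar N (R x + x) (R y + y) =
      normTrace N x * polar N (R 1) y + normTrace N y * polar N (R 1) x := by
    rw [polar, add_add_add_comm, ← map_add, h.norm_map_add, h.norm_map_add, h.norm_map_add,
      map_add, polar_add_right]
    ring
  rw [polar_add_left, polar_add_right, polar_add_right, h.polar_map_map] at hpolar
  linear_combination hpolar

theorem map_map_of_polar_eq_zero (h : IsPrimitiveRB N R) (hx : polar N (R 1) x = 0) :
    R (R x) = -R x := by
  rw [eq_neg_iff_add_eq_zero, h.sq_add, hx, zero_smul]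

theorem polar_eq_zero_of_map_eq_neg (h : IsPrimitiveRB N R) (hx : R x = -x) (hy : R y = -y) :
    polar N x y = 0 := by
  have hpolar := h.polar_map_map x y
  rwa [hx, hy, polar_neg_left, polar_neg_right, neg_neg] at hpolar

section

variable [IsScalarTower F A A] [SMulCommClass F A A]

theorem polar_mul_eq_zero_of_map_eq_neg (h : IsPrimitiveRB N R) (hRx : R x = -x) (hRy : R y = -y)
    (hRz : R z = -z) : polar N x (y * z) = 0 := by
  refine h.polar_eq_zero_of_map_eq_neg hRx ?_
  simpa only [one_smul] using
    h.isRotaBaxter.map_mul_of_map_eq_neg one_ne_zero (by rwa [one_smul]) (by rwa [one_smul])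

end

variable [IsQuadraticNorm N]

theorem isPrimIdem (h : IsPrimitiveRB N R) : IsPrimIdem N (R 1) where
  normTrace_eq_one := by
    have hadd := h.norm_map_add 1
    rw [QuadraticMap.map_add N, h.norm_map, apply_one, normTrace_one, ← normTrace_apply] at hadd
    linear_combination -hadd
  apply_eq_zero := h.norm_map 1

theorem map_map_one (h : IsPrimitiveRB N R) : R (R 1) = 0 := by
  have hsq := h.sq_add 1
  rwa [← normTrace_apply, h.isPrimIdem.normTrace_eq_one, one_smul, add_eq_right] at hsq

variable [IsScalarTower F A A] [SMulCommClass F A A]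

theorem map_mem_peirceSpace (h : IsPrimitiveRB N R) (hx : x ∈ peirceSpace F (R 1)) :
    R x ∈ peirceSpace F (R 1) := by
  have hRR := h.map_map_of_polar_eq_zero
    (h.isPrimIdem.normTrace_eq_zero_and_polar_eq_zero hx).2
  have hleft := h.isRotaBaxter.map_mul_map 1 x
  have hright := h.isRotaBaxter.map_mul_map x 1
  rw [one_mul, one_mul, hx.1, hRR, add_neg_cancel, zero_add] at hleft
  rw [mul_one, mul_one, hx.2, hRR, map_zero, add_zero, neg_add_cancel] at hright
  exact ⟨hleft, hright⟩

theorem map_mem_peirceSpace_one_sub (h : IsPrimitiveRB N R)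
    (hx : x ∈ peirceSpace F (1 - R 1)) : R x ∈ peirceSpace F (1 - R 1) := by
  have hRR := h.map_map_of_polar_eq_zero (h.isPrimIdem.polar_eq_zero_of_mem_one_sub hx)
  have hleft := h.isRotaBaxter.map_mul_map 1 x
  have hright := h.isRotaBaxter.map_mul_map x 1
  rw [mem_peirceSpace_one_sub_iff] at hx ⊢
  rw [one_mul, one_mul, hx.1, hRR, map_zero, zero_add, neg_add_cancel] at hleft
  rw [mul_one, mul_one, hx.2, hRR, neg_add_cancel, zero_add] at hright
  exact ⟨hleft, hright⟩

theorem polar_eq_zero_of_map_eq_zero (h : IsPrimitiveRB N R) (hRx : R x = 0) (hRy : R y = 0)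
    (hx : x ∈ peirceSpace F (R 1)) (hy : y ∈ peirceSpace F (1 - R 1)) : polar N x y = 0 := by
  have hpolar := h.polar_map_add_polar_map x y
  rwa [hRx, hRy, polar_zero_left, polar_zero_right, zero_add, zero_add,
    (h.isPrimIdem.normTrace_eq_zero_and_polar_eq_zero hx).1,
    (h.isPrimIdem.one_sub.normTrace_eq_zero_and_polar_eq_zero hy).1, zero_mul, zero_mul,
    add_zero] at hpolar

theorem exists_add_of_mem_peirceSpace (h : IsPrimitiveRB N R) (hx : x ∈ peirceSpace F (R 1)) :
    ∃ p ∈ peirceSpace F (R 1), ∃ q ∈ peirceSpace F (R 1), R p = 0 ∧ R q = -q ∧ x = p + q := by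
  have hRx := h.map_mem_peirceSpace hx
  have hRR := h.map_map_of_polar_eq_zero
    (h.isPrimIdem.normTrace_eq_zero_and_polar_eq_zero hx).2
  refine ⟨x + R x, add_mem hx hRx, -R x, neg_mem hRx, ?_, ?_, (add_neg_cancel_right _ _).symm⟩
  · rw [map_add, hRR, add_neg_cancel]
  · rw [map_neg, hRR]

variable [IsAlternative A]

theorem polar_mul_eq_zero_of_map_eq_zero (h : IsPrimitiveRB N R) (hx : x ∈ peirceSpace F (R 1))
    (hy : y ∈ peirceSpace F (R 1)) (hz : z ∈ peirceSpace F (R 1)) (hRx : R x = 0) (hRy : R y = 0)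
    (hRz : R z = 0) : polar N x (y * z) = 0 :=
  h.polar_eq_zero_of_map_eq_zero hRx
    (h.isRotaBaxter.map_mul_of_map_eq_zero one_ne_zero hRy hRz) hx
    (mul_mem_peirceSpace_one_sub hy hz)

theorem exists_polar_mul_ne_zero (h : IsPrimitiveRB N R) (hN : N.polarBilin.SeparatingLeft)
    (hrank : 4 < Module.finrank F A) :
    ∃ x ∈ peirceSpace F (R 1), ∃ y ∈ peirceSpace F (R 1), ∃ z ∈ peirceSpace F (R 1),
      polar N x (y * z) ≠ 0 ∧
        (R x = 0 ∧ R y = -y ∧ R z = -z ∨ R x = -x ∧ R y = 0 ∧ R z = 0) := by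
  have he := h.isPrimIdem
  obtain ⟨b, hb, c, hc, hbc⟩ := he.exists_mul_ne_zero hN hrank
  obtain ⟨a, ha, habc⟩ := he.one_sub.exists_polar_eq_one hN (mul_mem_peirceSpace_one_sub hb hc) hbc
  rw [sub_sub_cancel] at ha
  rw [polar_comm] at habc
  obtain ⟨a₀, ha₀, a₁, ha₁, hRa₀, hRa₁, rfl⟩ := h.exists_add_of_mem_peirceSpace ha
  obtain ⟨b₀, hb₀, b₁, hb₁, hRb₀, hRb₁, rfl⟩ := h.exists_add_of_mem_peirceSpace hb
  obtain ⟨c₀, hc₀, c₁, hc₁, hRc₀, hRc₁, rfl⟩ := h.exists_add_of_mem_peirceSpace hc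
  by_contra! hmixed
  have hleft {x y z : A} (hx : x ∈ peirceSpace F (R 1)) (hy : y ∈ peirceSpace F (R 1))
      (hz : z ∈ peirceSpace F (R 1)) (hRx : R x = 0) (hRy : R y = -y) (hRz : R z = -z) :
      polar N x (y * z) = 0 := by
    by_contra hne
    exact (hmixed x hx y hy z hz hne).1 hRx hRy hRz
  have hright {x y z : A} (hx : x ∈ peirceSpace F (R 1)) (hy : y ∈ peirceSpace F (R 1))
      (hz : z ∈ peirceSpace F (R 1)) (hRx : R x = -x) (hRy : R y = 0) (hRz : R z = 0) :
      polar N x (y * z) = 0 := by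
    by_contra hne
    exact (hmixed x hx y hy z hz hne).2 hRx hRy hRz
  simp only [add_mul, mul_add, polar_add_left, polar_add_right] at habc
  rw [h.polar_mul_eq_zero_of_map_eq_zero ha₀ hb₀ hc₀ hRa₀ hRb₀ hRc₀,
    h.polar_mul_eq_zero_of_map_eq_neg hRa₁ hRb₁ hRc₁,
    hleft ha₀ hb₁ hc₁ hRa₀ hRb₁ hRc₁, hright ha₁ hb₀ hc₀ hRa₁ hRb₀ hRc₀,
    he.polar_mul_cyclic ha₁ hb₀ hc₁, hleft hb₀ hc₁ ha₁ hRb₀ hRc₁ hRa₁,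
    he.polar_mul_cyclic ha₀ hb₁ hc₀, hright hb₁ hc₀ ha₀ hRb₁ hRc₀ hRa₀,
    ← he.polar_mul_cyclic hc₀ ha₁ hb₁, hleft hc₀ ha₁ hb₁ hRc₀ hRa₁ hRb₁,
    ← he.polar_mul_cyclic hc₁ ha₀ hb₀, hright hc₁ ha₀ hb₀ hRc₁ hRa₀ hRb₀] at habc
  simp at habc

theorem exists_isFrame (h : IsPrimitiveRB N R) (hN : N.polarBilin.SeparatingLeft)
    (hrank : 4 < Module.finrank F A) :
    ∃ v ε, IsFrame N (R 1) v ∧ (∀ i, R (v i) = -(ε i • v i)) ∧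
      (ε = ![0, 1, 1] ∨ ε = (![1, 0, 0] : Fin 3 → F)) := by
  obtain ⟨x, hx, y, hy, z, hz, hne, hR⟩ := h.exists_polar_mul_ne_zero hN hrank
  have hframe : IsFrame N (R 1) ![(polar N x (y * z))⁻¹ • x, y, z] :=
    h.isPrimIdem.isFrame (Submodule.smul_mem _ _ hx) hy hz
      (by rw [polar_smul_left, smul_eq_mul, inv_mul_cancel₀ hne])
  obtain ⟨hRx, hRy, hRz⟩ | ⟨hRx, hRy, hRz⟩ := hR
  · refine ⟨_, ![0, 1, 1], hframe, fun i ↦ ?_, .inl rfl⟩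
    fin_cases i <;> simp [hRx, hRy, hRz]
  · refine ⟨_, ![1, 0, 0], hframe, fun i ↦ ?_, .inr rfl⟩
    fin_cases i <;> simp [hRx, hRy, hRz]

variable {v : Fin 3 → A} {ε : Fin 3 → F}

theorem map_dualFrame (h : IsPrimitiveRB N R) (hv : IsFrame N (R 1) v)
    (hε : ∀ i, R (v i) = -(ε i • v i)) (i : Fin 3) :
    R (dualFrame v i) = ε i • dualFrame v i - dualFrame v i := by
  have hpolar (j : Fin 3) : polar N (R (dualFrame v i)) (v j) = 
      if i = j then ε i - 1 else 0 := by
    have hsum := h.polar_map_add_polar_map (dualFrame v i) (v j)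
    rw [(h.isPrimIdem.normTrace_eq_zero_and_polar_eq_zero (hv.mem j)).1,
      (h.isPrimIdem.one_sub.normTrace_eq_zero_and_polar_eq_zero (hv.dualFrame_mem i)).1, hε,
      polar_neg_right, polar_smul_right, polar_comm N (dualFrame v i), hv.polar_dualFrame,
      Matrix.one_apply] at hsum
    split_ifs with hij
    · subst hij
      simp only [if_true, smul_eq_mul] at hsum
      linear_combination hsum
    · simp only [Ne.symm hij, if_false, smul_eq_mul] at hsum
      linear_combination hsum
  rw [hv.dual.eq_linearCombination (h.map_mem_peirceSpace_one_sub (hv.dualFrame_mem i)),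
    hv.dualFrame_dualFrame]
  simp only [hpolar, Fintype.linearCombination_apply, ite_smul, zero_smul, Finset.sum_ite_eq,
    Finset.mem_univ, if_true, sub_smul, one_smul]

theorem map_frameMap (h : IsPrimitiveRB N R) (hv : IsFrame N (R 1) v)
    (hε : ∀ i, R (v i) = -(ε i • v i)) {a b : SplitOctonion F} (h₀ : b.m 0 0 = a.m 1 1)
    (h₁ : b.m 1 1 = 0) (hupper : upper b = -(ε * upper a))
    (hlower : lower b = ε * lower a - lower a) :
    R (frameMap (R 1) v a) = frameMap (R 1) v b := by
  rw [frameMap_apply, frameMap_apply, h₀, h₁, hupper, hlower]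
  simp only [Fintype.linearCombination_apply, map_add, map_sub, map_smul, hε,
    h.map_map_one, h.map_dualFrame hv hε, smul_zero, zero_smul, sub_zero, zero_add, add_zero,
    Pi.neg_apply, Pi.mul_apply, Fin.sum_univ_three]
  module

theorem exists_conj_eq (h : IsPrimitiveRB N R) (hN : N.polarBilin.SeparatingLeft)
    (hrank : 4 < Module.finrank F A) :
    ∃ ψ : A ≃ₗ[F] SplitOctonion F,
      ((∀ x y, ψ (x * y) = ψ x * ψ y) ∨ ∀ x y, ψ (x * y) = ψ y * ψ x) ∧ ψ.conj R = R₁ := by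
  obtain ⟨v, ε, hv, hε, rfl | rfl⟩ := h.exists_isFrame hN hrank
  · refine ⟨hv.frameEquiv.symm, .inl hv.frameEquiv_symm_mul, LinearMap.ext fun a ↦ ?_⟩
    rw [LinearEquiv.conj_apply_apply, LinearEquiv.symm_symm, LinearEquiv.symm_apply_eq]
    exact h.map_frameMap hv hε rfl rfl
      (by ext i; fin_cases i <;> simp [upper_apply, R₁])
      (by ext i; fin_cases i <;> simp [lower_apply, R₁])
  · refine ⟨hv.frameEquiv.symm.trans transpose, .inr fun x y ↦ ?_, LinearMap.ext fun a ↦ ?_⟩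
    · rw [LinearEquiv.trans_apply, hv.frameEquiv_symm_mul, transpose_mul]
      rfl
    · rw [LinearEquiv.conj_apply_apply, LinearEquiv.trans_apply, ← LinearEquiv.eq_symm_apply,
        LinearEquiv.symm_apply_eq]
      exact h.map_frameMap hv hε rfl rfl
        (by ext i; fin_cases i <;> simp [upper_apply, R₁, transpose, sympInv])
        (by ext i; fin_cases i <;> simp [lower_apply, R₁, transpose, sympInv])

end IsPrimitiveRB

end NormalForm

theorem theorem1_general {F A : Type*} [Field F] [NonAssocRing A] [Module F A]
    [IsScalarTower F A A] [SMulCommClass F A A] [IsAlternative A] (N : QuadraticForm F A)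
    [IsQuadraticNorm N] (hN : N.polarBilin.SeparatingLeft) (hrank : 4 < Module.finrank F A)
    (lam : F) (hlam : lam ≠ 0) (R : A →ₗ[F] A) (hR : IsRotaBaxter lam R)
    (hns : ¬ IsSplittingRB lam R) :
    ∃ (c : F) (ψ : A ≃ₗ[F] SplitOctonion F),
      c ≠ 0 ∧ ((∀ x y, ψ (x * y) = ψ x * ψ y) ∨ ∀ x y, ψ (x * y) = ψ y * ψ x) ∧
      (ψ.conj (c • R) = SplitOctonion.R₁ ∨ ψ.conj (c • phiRB lam R) = SplitOctonion.R₁) := by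
  have hS : IsRotaBaxter (1 : F) (lam⁻¹ • R) := by
    simpa only [inv_mul_cancel₀ hlam] using hR.smul lam⁻¹
  obtain ⟨x, hx⟩ : ∃ x, (lam⁻¹ • R) ((lam⁻¹ • R) x) + (lam⁻¹ • R) x ≠ 0 := by
    by_contra! hsq
    refine hns ?_
    simpa only [mul_one, smul_inv_smul₀ hlam] using (hS.isSplittingRB hsq).smul lam
  have hφ : phiRB 1 (lam⁻¹ • R) = lam⁻¹ • phiRB lam R := by
    rw [← phiRB_smul, inv_mul_cancel₀ hlam]
  have htr := IsQuadraticNorm.normTrace_ne_zero hN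
  rcases hS.isPrimitiveRB_or htr hx with h | h
  · obtain ⟨ψ, hψ, hconj⟩ := h.exists_conj_eq hN hrank
    exact ⟨lam⁻¹, ψ, inv_ne_zero hlam, hψ, .inl hconj⟩
  · obtain ⟨ψ, hψ, hconj⟩ := h.exists_conj_eq hN hrank
    exact ⟨lam⁻¹, ψ, inv_ne_zero hlam, hψ, .inr (hφ ▸ hconj)⟩

theorem theorem1 {F : Type*} [Field F] (lam : F) (hlam : lam ≠ 0)
    (R : SplitOctonion F →ₗ[F] SplitOctonion F)
    (hR : IsRotaBaxter lam R) (hns : ¬ IsSplittingRB lam R) :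
    ∃ (c : F) (ψ : SplitOctonion F ≃ₗ[F] SplitOctonion F),
      c ≠ 0 ∧ (IsAlgAut ψ ∨ IsAlgAntiAut ψ) ∧
      (ψ.conj (c • R) = SplitOctonion.R₁ ∨
        ψ.conj (c • phiRB lam R) = SplitOctonion.R₁) :=
  let _ := SplitOctonion.nonAssocRing (F := F)
  theorem1_general SplitOctonion.norm SplitOctonion.separatingLeft_norm
    (SplitOctonion.finrank_eq (F := F) ▸ by norm_num) lam hlam R hR hns
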